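/- Let $G$ be a finite non-solvable group. For $x \in G$ let $nil_G(x) = \{y \in G \mid \langle x, y\rangle \text{ is nilpotent}\}$ be the nilpotentizer of $x$ in $G$ (a subset of $G$, not necessarily a subgroup), and let $Z^*(G)$ denote the hypercenter of $G$, i.e. the final term of the upper central series of $G$. Let $x \in G$ be such that $nil_G(x)$ generates a maximal subgroup $M$ of $G$, and suppose that $Z^*(G) \neq 1$ and $Z^*(G) \le M$. Then: 1. $|nil_G(x)| \neq p^3$ for every prime $p$; 2. $|nil_G(x)| \neq pq$ for all distinct primes $p$ and $q$. -/

import Mathlib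

/-- The nilpotentizer of `x` in `G`: the set of all `y` such that the subgroup generated by
`x` and `y` is nilpotent. It need not be a subgroup. -/
def nilpotentizer {G : Type*} [Group G] (x : G) : Set G :=
  {y : G | Group.IsNilpotent (Subgroup.closure ({x, y} : Set G))}

/-- The hypercenter of a finite group: the union of its (finite) upper central series.
For a finite group the series becomes stationary after finitely many steps, so no transfinite
continuation is needed; the definition is only meant for finite groups. -/
def hypercenter (G : Type*) [Group G] [Finite G] : Subgroup G :=
  ⨆ n : ℕ, Subgroup.upperCentralSeries G n

/-! Let Z be the hypercenter. Joining Z to a nilpotent subgroup keeps it nilpotent, so nil(x) is a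
union of left cosets of K = ⟨x⟩Z and |K| divides |nil(x)|. Also x ∉ Z, since otherwise nil(x) = G =
M; hence 1 < |Z| < |K|. If |nil(x)| is p^3 or pq, this forces nil(x) to be a subgroup, so it equals
M. As Z ≠ 1, the maximal subgroup M/Z of G/Z then has prime power order p^k with k ≤ 2, so it is an
abelian p-group. By `isSolvable_of_isCoatom_of_isPGroup` G/Z is solvable, and so is G because Z is
nilpotent. -/

/-- A finite group with a commutative maximal subgroup of prime power order is solvable. -/
theorem isSolvable_of_isCoatom_of_isPGroup {G : Type*} [Group G] [Finite G] {p : ℕ}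
    [Fact p.Prime] (A : Subgroup G) (hA : IsCoatom A) (hpA : IsPGroup p A)
    (hcomm : ∀ a ∈ A, ∀ b ∈ A, a * b = b * a) : Group.IsSolvable G := by
  have hAs : Group.IsSolvable A :=
    Group.isSolvable_of_comm fun a b => Subtype.ext (hcomm a a.2 b b.2)
  by_cases hn : A.Normal
  · obtain ⟨g, -, hg⟩ := SetLike.exists_of_lt hA.lt_top
    have hsup : A ⊔ Subgroup.zpowers g = ⊤ :=
      hA.2 _ (left_lt_sup.2 fun h => hg (h (Subgroup.mem_zpowers g)))
    have hmap : Subgroup.zpowers (QuotientGroup.mk' A g) = ⊤ := by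
      have h := congrArg (Subgroup.map (QuotientGroup.mk' A)) hsup
      rwa [Subgroup.map_sup, QuotientGroup.map_mk'_self, bot_sup_eq, MonoidHom.map_zpowers,
        Subgroup.map_top_of_surjective _ (QuotientGroup.mk'_surjective A)] at h
    have hcyc : IsCyclic (G ⧸ A) :=
      ⟨QuotientGroup.mk' A g, fun y => Subgroup.mem_zpowers_iff.1 (hmap ▸ Subgroup.mem_top y)⟩
    have : Group.IsSolvable (G ⧸ A) :=
      Group.isSolvable_of_comm fun a b => (IsCyclic.commGroup (α := G ⧸ A)).mul_comm a b
    exact (Group.isSolvable_iff_subgroup_quotient A).2 ⟨hAs, this⟩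
  have hnorm : Subgroup.normalizer (A : Set G) = A :=
    Subgroup.le_normalizer.eq_or_lt.elim Eq.symm
      fun h => absurd (Subgroup.normalizer_eq_top_iff.1 (hA.2 _ h)) hn
  obtain ⟨P, hAP⟩ := hpA.exists_le_sylow
  rcases hAP.eq_or_lt with hAP | hAP
  swap
  · have hG : IsPGroup p G := by
      have h := P.2
      rw [hA.2 _ hAP] at h
      exact h.of_equiv Subgroup.topEquiv
    have := hG.isNilpotent
    infer_instance
  -- Burnside's transfer theorem: the abelian, self-normalizing Sylow subgroup A is central in its
  -- normalizer, so it has a normal complement N.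
  have hP : Subgroup.normalizer (P : Set G) ≤ Subgroup.centralizer (P : Set G) := by
    have hPA : (P : Set G) = A := by rw [hAP]; rfl
    rw [hPA, hnorm]
    exact fun a ha b hb => hcomm b hb a ha
  set N := (MonoidHom.transferSylow P hP).ker with hN
  have hpN : ¬ p ∣ Nat.card N := MonoidHom.not_dvd_card_ker_transferSylow P hP
  have hcompl : N.IsComplement' A := hAP ▸ MonoidHom.ker_transferSylow_isComplement' P hP
  have hN1 : Nat.card N ≠ 1 := fun h => hA.1 <| by
    rw [Subgroup.card_eq_one.1 h] at hcompl
    simpa using hcompl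
  obtain ⟨r, hr, hrN⟩ := Nat.exists_prime_and_dvd hN1
  have : Fact r.Prime := ⟨hr⟩
  have hrp : r ≠ p := fun h => hpN (h ▸ hrN)
  have hns : ¬ p ∣ Nat.card (Sylow r N) := fun h =>
    hpN ((h.trans ((default : Sylow r N).card_dvd_index)).trans
      (Subgroup.index_dvd_card _))
  -- A permutes the Sylow r-subgroups of N by conjugation. Their number divides |N|, so it is prime
  -- to p and the p-group A fixes one of them.
  let _ : MulAction A (Sylow r N) :=
    MulAction.compHom (Sylow r N) ((MulAut.conjNormal (H := N)).comp A.subtype)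
  obtain ⟨R, hR⟩ := hpA.nonempty_fixed_point_of_prime_not_dvd_card (Sylow r N) hns
  set R' := (R : Subgroup N).map N.subtype with hR'
  have hAR : A ≤ Subgroup.normalizer (R' : Set G) := by
    have key : ∀ a ∈ A, ∀ g ∈ R', a * g * a⁻¹ ∈ R' := by
      rintro a ha _ ⟨n, hn, rfl⟩
      refine ⟨MulAut.conjNormal a n, ?_, by simp⟩
      have h : (MulAut.conjNormal (H := N) a) • R = R := hR ⟨a, ha⟩
      have h2 := Subgroup.smul_mem_pointwise_smul n (MulAut.conjNormal (H := N) a) R hn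
      rw [← Sylow.pointwise_smul_def, h] at h2
      exact h2
    intro a ha
    rw [Subgroup.mem_normalizer_iff]
    refine fun g => ⟨key a ha g, fun h => ?_⟩
    simpa [mul_assoc] using key a⁻¹ (A.inv_mem ha) _ h
  have hR'r : IsPGroup r R' := R.2.map _
  have hR'1 : R' ≠ ⊥ := by
    rw [hR', Ne, Subgroup.map_eq_bot_iff_of_injective _ N.subtype_injective]
    exact R.ne_bot_of_dvd_card hrN
  have hR'A : ¬ R' ≤ A := fun h =>
    hR'1 (disjoint_self.1 ((IsPGroup.disjoint_of_ne r p hrp _ _ hR'r hpA).mono_right h))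
  -- The normalizer of R' contains A and, as R' is not inside A, properly so; maximality makes it G.
  have hnR : R'.Normal := by
    rw [← Subgroup.normalizer_eq_top_iff]
    refine hA.2 _ (lt_of_le_of_ne hAR fun h => hR'A ?_)
    rw [h]
    exact Subgroup.le_normalizer
  have hsup : A ⊔ R' = ⊤ := hA.2 _ (left_lt_sup.2 hR'A)
  have hR's : Group.IsSolvable R' := by
    have := hR'r.isNilpotent
    infer_instance
  refine (Group.isSolvable_iff_subgroup_quotient R').2 ⟨hR's, ?_⟩
  refine Group.isSolvable_of_surjective (f := (QuotientGroup.mk' R').comp A.subtype) ?_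
  rw [← MonoidHom.range_eq_top, MonoidHom.range_comp, Subgroup.range_subtype]
  have h := congrArg (Subgroup.map (QuotientGroup.mk' R')) hsup
  rwa [Subgroup.map_sup, QuotientGroup.map_mk'_self, sup_bot_eq,
    Subgroup.map_top_of_surjective _ (QuotientGroup.mk'_surjective R')] at h

/-! ### Nilpotency and the hypercenter -/

/-- The join of a nilpotent subgroup with a term of the upper central series is nilpotent. -/
theorem isNilpotent_sup_upperCentralSeries (n : ℕ) : ∀ {G : Type*} [Group G] (H : Subgroup G),
    Group.IsNilpotent H → Group.IsNilpotent (H ⊔ Subgroup.upperCentralSeries G n : Subgroup G) := by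
  induction n with
  | zero => intro G _ H hH; rwa [Subgroup.upperCentralSeries_zero, sup_bot_eq]
  | succ n ih =>
    intro G _ H hH
    -- Modulo the center, term n + 1 becomes term n, and a central extension of a nilpotent group is
    -- nilpotent.
    set f := QuotientGroup.mk' (Subgroup.center G)
    set L := H ⊔ Subgroup.upperCentralSeries G (n + 1)
    have h1 : Group.IsNilpotent (H.map f) :=
      Group.nilpotent_of_surjective _ (f.subgroupMap_surjective H)
    have h2 := ih (H.map f) h1
    have h3 : L.map f = H.map f ⊔ Subgroup.upperCentralSeries _ n := by
      rw [Subgroup.map_sup, ← Subgroup.comap_upperCentralSeries_quotient_center,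
        Subgroup.map_comap_eq_self_of_surjective (QuotientGroup.mk'_surjective _)]
    rw [← h3] at h2
    refine Subgroup.isNilpotent_of_ker_le_center (f.subgroupMap L) fun y hy => ?_
    rw [Subgroup.mem_center_iff]
    intro g
    have : (y : G) ∈ Subgroup.center G := by
      rw [← QuotientGroup.eq_one_iff]
      exact congrArg Subtype.val hy
    exact Subtype.ext (Subgroup.mem_center_iff.1 this g)

theorem exists_hypercenter_eq_upperCentralSeries (G : Type*) [Group G] [Finite G] :
    ∃ n, hypercenter G = Subgroup.upperCentralSeries G n :=
  let f : ℕ →o Subgroup G :=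
    ⟨Subgroup.upperCentralSeries G, Subgroup.upperCentralSeries_mono G⟩
  ⟨monotonicSequenceLimitIndex f, le_antisymm (iSup_le fun m => le_monotonicSequenceLimit f m)
    (le_iSup (Subgroup.upperCentralSeries G) _)⟩

instance hypercenter_normal (G : Type*) [Group G] [Finite G] : (hypercenter G).Normal := by
  obtain ⟨n, hn⟩ := exists_hypercenter_eq_upperCentralSeries G
  rw [hn]
  infer_instance

theorem isNilpotent_sup_hypercenter {G : Type*} [Group G] [Finite G] (H : Subgroup G)
    (hH : Group.IsNilpotent H) : Group.IsNilpotent (H ⊔ hypercenter G : Subgroup G) := by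
  obtain ⟨n, hn⟩ := exists_hypercenter_eq_upperCentralSeries G
  rw [hn]
  exact isNilpotent_sup_upperCentralSeries n H hH

theorem isNilpotent_of_isMulCommutative (G : Type*) [Group G] [IsMulCommutative G] :
    Group.IsNilpotent G :=
  ⟨1, by
    rw [Subgroup.upperCentralSeries_one, Subgroup.eq_top_iff']
    exact fun a => Subgroup.mem_center_iff.2 fun b => mul_comm' b a⟩

theorem isNilpotent_zpowers {G : Type*} [Group G] (x : G) :
    Group.IsNilpotent (Subgroup.zpowers x) := isNilpotent_of_isMulCommutative _

theorem isNilpotent_of_le {G : Type*} [Group G] {H K : Subgroup G} (h : H ≤ K)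
    (hK : Group.IsNilpotent K) : Group.IsNilpotent H :=
  (Group.isNilpotent_congr (Subgroup.subgroupOfEquivOfLe h)).1 inferInstance

/-! ### Nilpotentizers as unions of cosets -/

theorem subset_nilpotentizer {G : Type*} [Group G] {x : G} {H : Subgroup G}
    (hH : Group.IsNilpotent H) (hx : x ∈ H) : (H : Set G) ⊆ nilpotentizer x := fun y hy =>
  isNilpotent_of_le (by simp [Subgroup.closure_le, Set.insert_subset_iff, hx, show y ∈ H from hy])
    hH

theorem nilpotentizer_eq_univ {G : Type*} [Group G] [Finite G] {x : G}
    (hx : x ∈ hypercenter G) : nilpotentizer x = Set.univ :=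
  Set.eq_univ_of_forall fun y =>
    subset_nilpotentizer (isNilpotent_sup_hypercenter _ (isNilpotent_zpowers y))
      (Subgroup.mem_sup_right hx) (Subgroup.mem_sup_left (Subgroup.mem_zpowers y))

theorem mem_nilpotentizer_of_commute {G : Type*} [Group G] {x y : G} (h : x * y = y * x) :
    y ∈ nilpotentizer x := by
  have : IsMulCommutative (Subgroup.closure ({x, y} : Set G)) :=
    Subgroup.isMulCommutative_closure (by simp [h])
  exact isNilpotent_of_isMulCommutative _

/-- If ⟨x, y⟩ is nilpotent, so is ⟨x, y⟩Z, which contains the whole coset yK. -/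
theorem card_dvd_card_nilpotentizer {G : Type*} [Group G] [Finite G] (x : G) :
    Nat.card (Subgroup.zpowers x ⊔ hypercenter G : Subgroup G) ∣ Nat.card (nilpotentizer x) := by
  set K := Subgroup.zpowers x ⊔ hypercenter G
  have h : (QuotientGroup.mk : G → G ⧸ K) ⁻¹' (QuotientGroup.mk '' nilpotentizer x) =
      nilpotentizer x := by
    refine Set.Subset.antisymm ?_ (Set.subset_preimage_image _ _)
    rintro z ⟨y, hy, hyz⟩
    rw [QuotientGroup.eq] at hyz
    have hL := isNilpotent_sup_hypercenter _ hy
    have hx : x ∈ Subgroup.closure {x, y} ⊔ hypercenter G :=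
      Subgroup.mem_sup_left (Subgroup.subset_closure (by simp))
    have hy' : y ∈ Subgroup.closure {x, y} ⊔ hypercenter G :=
      Subgroup.mem_sup_left (Subgroup.subset_closure (by simp))
    refine subset_nilpotentizer hL hx ?_
    have hK : K ≤ Subgroup.closure {x, y} ⊔ hypercenter G :=
      sup_le (by simpa using hx) le_sup_right
    simpa using mul_mem hy' (hK hyz)
  rw [← h, Nat.card_congr (QuotientGroup.preimageMkEquivSubgroupProdSet K _), Nat.card_prod]
  exact dvd_mul_right _ _

theorem closure_nilpotentizer_eq_of_card {G : Type*} [Group G] [Finite G] {x : G} {H : Subgroup G}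
    (hH : (H : Set G) ⊆ nilpotentizer x)
    (hcard : Nat.card (nilpotentizer x) ≤ Nat.card H) :
    Subgroup.closure (nilpotentizer x) = H := by
  rw [← Set.eq_of_subset_of_ncard_le hH hcard, Subgroup.closure_eq]

/-! ### Descent to the quotient by Z -/

theorem isSolvable_of_isCoatom_of_card_map {G : Type*} [Group G] [Finite G] (Z M : Subgroup G)
    [Z.Normal] [Group.IsSolvable Z] (hM : IsCoatom M) (hZM : Z ≤ M) {p k : ℕ} (hp : p.Prime)
    (hk : k ≤ 2) (hcard : Nat.card (M.map (QuotientGroup.mk' Z)) = p ^ k) :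
    Group.IsSolvable G := by
  have : Fact p.Prime := ⟨hp⟩
  refine (Group.isSolvable_iff_subgroup_quotient Z).2 ⟨‹_›, ?_⟩
  have hcomap : (M.map (QuotientGroup.mk' Z)).comap (QuotientGroup.mk' Z) = M := by
    rw [Subgroup.comap_map_eq, QuotientGroup.ker_mk', sup_of_le_left hZM]
  have hsurj := QuotientGroup.mk'_surjective Z
  refine isSolvable_of_isCoatom_of_isPGroup (p := p) (M.map (QuotientGroup.mk' Z))
    ⟨fun h => hM.1 ?_, fun B hB => ?_⟩ (IsPGroup.of_card hcard) ?_
  · rw [← hcomap, h, Subgroup.comap_top]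
  · rw [← Subgroup.comap_lt_comap_of_surjective hsurj, hcomap] at hB
    rw [← Subgroup.map_comap_eq_self_of_surjective hsurj B, hM.2 _ hB,
      Subgroup.map_top_of_surjective _ hsurj]
  · suffices IsMulCommutative (M.map (QuotientGroup.mk' Z)) from
      fun a ha b hb => congrArg Subtype.val (this.is_comm.comm ⟨a, ha⟩ ⟨b, hb⟩)
    interval_cases k
    · have := (Nat.card_eq_one_iff_unique.1 (hcard.trans (pow_zero p))).1
      exact ⟨⟨fun _ _ => Subsingleton.elim _ _⟩⟩
    · have := isCyclic_of_prime_card (hcard.trans (pow_one p))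
      exact ⟨⟨IsCyclic.commGroup.mul_comm⟩⟩
    · exact IsPGroup.isMulCommutative_of_card_eq_prime_sq hcard

theorem card_map_mk'_mul_card {G : Type*} [Group G] (Z M : Subgroup G) [Z.Normal] (h : Z ≤ M) :
    Nat.card (M.map (QuotientGroup.mk' Z)) * Nat.card Z = Nat.card M := by
  rw [← Subgroup.relIndex_ker, QuotientGroup.ker_mk', mul_comm, ← Subgroup.relIndex_bot_left,
    Subgroup.relIndex_mul_relIndex _ _ _ bot_le h, Subgroup.relIndex_bot_left]

/-! ### Nilpotentizers that are subgroups -/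

/-- In a finite nilpotent group, a subgroup of order `p ^ 2` is central
if `p ^ 3` does not divide the order of the group. -/
theorem commute_of_card_eq_prime_sq {G : Type*} [Group G] [Finite G] [Group.IsNilpotent G]
    {p : ℕ} [Fact p.Prime] (K : Subgroup G) (hK : Nat.card K = p ^ 2)
    (hG : ¬ p ^ 3 ∣ Nat.card G) {x : G} (hx : x ∈ K) (y : G) : x * y = y * x := by
  obtain ⟨e⟩ := ((Group.isNilpotent_of_finite_tfae (G := G)).out 0 4 rfl rfl).1 ‹_›
  apply e.symm.injective
  rw [map_mul, map_mul]
  funext q Q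
  rw [Pi.mul_apply, Pi.mul_apply, Pi.mul_apply, Pi.mul_apply]
  have : Fact (q : ℕ).Prime := ⟨Nat.prime_of_mem_primeFactors q.2⟩
  -- In the product of Sylow subgroups, the p-factor has order exactly p^2, hence is abelian; x is
  -- trivial in every other factor.
  by_cases hq : (q : ℕ) = p
  · obtain ⟨k, hk⟩ := IsPGroup.iff_card.1 Q.2
    have hk2 : k ≤ 2 := by
      by_contra! h
      refine hG ((pow_dvd_pow p h).trans ?_)
      rw [← hq, ← hk]
      exact Subgroup.card_subgroup_dvd_card _
    have h2k : 2 ≤ k := by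
      have h := Q.card_eq_multiplicity
      rw [hk] at h
      rw [Nat.pow_right_injective (Fact.out : (q : ℕ).Prime).two_le h,
        ← (Fact.out : (q : ℕ).Prime).pow_dvd_iff_le_factorization Nat.card_pos.ne', hq, ← hK]
      exact Subgroup.card_subgroup_dvd_card _
    obtain rfl := le_antisymm hk2 h2k
    exact (IsPGroup.isMulCommutative_of_card_eq_prime_sq hk).is_comm.comm _ _
  · suffices e.symm x q Q = 1 by rw [this, one_mul, mul_one]
    obtain ⟨k, hk⟩ := IsPGroup.iff_orderOf.1 Q.2 (e.symm x q Q)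
    have h1 : x ^ p ^ 2 = 1 := by
      rw [← hK]
      exact congrArg Subtype.val (pow_card_eq_one' (x := (⟨x, hx⟩ : K)))
    have h2 : (e.symm x q Q) ^ p ^ 2 = 1 := by
      rw [← Pi.pow_apply, ← Pi.pow_apply, ← map_pow, h1, map_one]
      rfl
    have h3 := orderOf_dvd_of_pow_eq_one h2
    rw [← orderOf_eq_one_iff]
    exact Nat.eq_one_of_dvd_coprimes
      (Nat.Coprime.pow _ _ ((Nat.coprime_primes Fact.out Fact.out).2 hq)) (dvd_of_eq hk) h3

theorem card_closure_nilpotentizer_of_card_eq_prime_pow_three {G : Type*} [Group G] [Finite G]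
    {x : G} {p : ℕ} (hp : p.Prime) (hcard : Nat.card (nilpotentizer x) = p ^ 3)
    (hx : x ∉ hypercenter G) (hZ : hypercenter G ≠ ⊥) :
    Nat.card (Subgroup.closure (nilpotentizer x)) = p ^ 3 := by
  have : Fact p.Prime := ⟨hp⟩
  have hof : ∀ H : Subgroup G, (H : Set G) ⊆ nilpotentizer x → Nat.card H = p ^ 3 →
      Nat.card (Subgroup.closure (nilpotentizer x)) = p ^ 3 := fun H hH h => by
    rw [closure_nilpotentizer_eq_of_card hH (hcard.trans h.symm).le, h]
  set K := Subgroup.zpowers x ⊔ hypercenter G with hKdef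
  have hxK : x ∈ K := Subgroup.mem_sup_left (Subgroup.mem_zpowers x)
  have hKnil : Group.IsNilpotent K := isNilpotent_sup_hypercenter _ (isNilpotent_zpowers x)
  have hZK : hypercenter G < K := lt_of_le_of_ne le_sup_right fun h => hx (h ▸ hxK)
  obtain ⟨k, hk3, hk⟩ := (Nat.dvd_prime_pow hp).1 (hcard ▸ card_dvd_card_nilpotentizer x)
  obtain ⟨j, -, hj⟩ := (Nat.dvd_prime_pow hp).1 (hk ▸ Subgroup.card_dvd_of_le hZK.le)
  have hj0 : j ≠ 0 := by
    rintro rfl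
    exact hZ (Subgroup.card_eq_one.1 (hj.trans (pow_zero p)))
  have hjk : j < k := by
    rw [← Nat.pow_lt_pow_iff_right hp.one_lt, ← hj, ← hk]
    exact Set.ncard_lt_ncard hZK (Set.toFinite _)
  -- Here |Z| ≥ p and Z < K. If |K| = p^3, then K fills nil(x).
  obtain rfl | rfl : k = 3 ∨ k = 2 := by omega
  · exact hof K (subset_nilpotentizer hKnil hxK) hk
  by_cases hex : ∃ y ∈ nilpotentizer x,
      Nat.card (Subgroup.closure {x, y} ⊔ hypercenter G : Subgroup G) = p ^ 3
  · obtain ⟨y, hy, hL⟩ := hex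
    exact hof _ (subset_nilpotentizer (isNilpotent_sup_hypercenter _ hy)
      (Subgroup.mem_sup_left (Subgroup.subset_closure (by simp)))) hL
  push Not at hex
  -- Now each L = ⟨x, y⟩Z has order below p^3, so K, of order p^2, is central in L: nil(x) is the
  -- centralizer of x.
  have hC : (Subgroup.centralizer {x} : Set G) = nilpotentizer x := by
    refine Set.Subset.antisymm
      (fun y hy => mem_nilpotentizer_of_commute (Subgroup.mem_centralizer_singleton_iff.1 hy).symm)
      fun y hy => ?_
    have hL := isNilpotent_sup_hypercenter _ hy
    set L := Subgroup.closure {x, y} ⊔ hypercenter G with hLdef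
    have hxL : x ∈ L := Subgroup.mem_sup_left (Subgroup.subset_closure (by simp))
    have hyL : y ∈ L := Subgroup.mem_sup_left (Subgroup.subset_closure (by simp))
    have hKL : K ≤ L := sup_le (by simpa using hxL) le_sup_right
    have hle : Nat.card L ≤ p ^ 3 :=
      hcard ▸ Set.ncard_le_ncard (subset_nilpotentizer hL hxL) (Set.toFinite _)
    have hnd : ¬ p ^ 3 ∣ Nat.card L := fun h =>
      hex y hy (le_antisymm hle (Nat.le_of_dvd Nat.card_pos h))
    have h := commute_of_card_eq_prime_sq (K.subgroupOf L)
      ((Nat.card_congr (Subgroup.subgroupOfEquivOfLe hKL).toEquiv).trans hk) hnd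
      (x := ⟨x, hxL⟩) hxK ⟨y, hyL⟩
    exact Subgroup.mem_centralizer_singleton_iff.2 (congrArg Subtype.val h).symm
  refine hof (Subgroup.centralizer {x}) hC.subset ?_
  rw [← hcard, ← hC]
  rfl

theorem card_closure_nilpotentizer_of_card_eq_mul {G : Type*} [Group G] [Finite G]
    {x : G} {p q : ℕ} (hp : p.Prime) (hq : q.Prime)
    (hcard : Nat.card (nilpotentizer x) = p * q)
    (hx : x ∉ hypercenter G) (hZ : hypercenter G ≠ ⊥) :
    Nat.card (Subgroup.closure (nilpotentizer x)) = p * q := by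
  set K := Subgroup.zpowers x ⊔ hypercenter G with hKdef
  have hxK : x ∈ K := Subgroup.mem_sup_left (Subgroup.mem_zpowers x)
  have hKnil : Group.IsNilpotent K := isNilpotent_sup_hypercenter _ (isNilpotent_zpowers x)
  have hZK : hypercenter G < K := lt_of_le_of_ne le_sup_right fun h => hx (h ▸ hxK)
  have hnp : ¬ (Nat.card K).Prime := fun h => by
    rcases (Nat.dvd_prime h).1 (Subgroup.card_dvd_of_le hZK.le) with h1 | h1
    · exact hZ (Subgroup.card_eq_one.1 h1)
    · exact (Set.ncard_lt_ncard hZK (Set.toFinite _)).ne h1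
  have hn1 : Nat.card K ≠ 1 := fun h =>
    hZ (le_bot_iff.1 (hZK.le.trans (Subgroup.card_eq_one.1 h).le))
  -- |K| divides pq and is neither 1 nor prime, because 1 < Z < K.
  have hKc : Nat.card K = p * q := by
    obtain ⟨a, b, ha, hb, hab⟩ := Nat.dvd_mul.1 (hcard ▸ card_dvd_card_nilpotentizer x)
    change a * b = Nat.card K at hab
    rcases (Nat.dvd_prime hp).1 ha with rfl | rfl <;> rcases (Nat.dvd_prime hq).1 hb with rfl | rfl
    · exact absurd hab.symm hn1
    · exact absurd (by rwa [← hab, one_mul]) hnp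
    · exact absurd (by rwa [← hab, mul_one]) hnp
    · exact hab.symm
  rw [closure_nilpotentizer_eq_of_card (subset_nilpotentizer hKnil hxK) (hcard.trans hKc.symm).le,
    hKc]

theorem mainTheorem4 {G : Type*} [Group G] [Finite G] (hG : ¬ Group.IsSolvable G)
    (x : G) (M : Subgroup G) (hM : Subgroup.closure (nilpotentizer x) = M) (hmax : IsCoatom M)
    (hZ : hypercenter G ≠ ⊥) (hZM : hypercenter G ≤ M) :
    (∀ p : ℕ, p.Prime → Nat.card (nilpotentizer x) ≠ p ^ 3) ∧
    (∀ p q : ℕ, p.Prime → q.Prime → p ≠ q → Nat.card (nilpotentizer x) ≠ p * q) := by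
  have hx : x ∉ hypercenter G := fun h => hmax.1 <| by
    rw [← hM, nilpotentizer_eq_univ h, Subgroup.closure_univ]
  have hZnil : Group.IsNilpotent (hypercenter G) :=
    isNilpotent_of_le le_sup_right (isNilpotent_sup_hypercenter _ (isNilpotent_zpowers (1 : G)))
  have hZ1 : Nat.card (hypercenter G) ≠ 1 := fun h => hZ (Subgroup.card_eq_one.1 h)
  have hcardZ := card_map_mk'_mul_card (hypercenter G) M hZM
  have hsol : ∀ {p k : ℕ}, p.Prime → k ≤ 2 →
      Nat.card (M.map (QuotientGroup.mk' (hypercenter G))) ≠ p ^ k := fun hp hk h =>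
    hG (isSolvable_of_isCoatom_of_card_map (hypercenter G) M hmax hZM hp hk h)
  refine ⟨fun p hp hcard => ?_, fun p q hp hq _ hcard => ?_⟩
  · have hMc := card_closure_nilpotentizer_of_card_eq_prime_pow_three hp hcard hx hZ
    rw [hM] at hMc
    rw [hMc] at hcardZ
    obtain ⟨k, hk3, hk⟩ := (Nat.dvd_prime_pow hp).1 (Dvd.intro _ hcardZ)
    rcases hk3.lt_or_eq with h | rfl
    · exact hsol hp (Nat.lt_succ_iff.1 h) hk
    · rw [hk] at hcardZ
      exact hZ1 (Nat.eq_of_mul_eq_mul_left (pow_pos hp.pos 3) (hcardZ.trans (mul_one _).symm))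
  · have hMc := card_closure_nilpotentizer_of_card_eq_mul hp hq hcard hx hZ
    rw [hM] at hMc
    rw [hMc] at hcardZ
    obtain ⟨a, b, ha, hb, hab⟩ := Nat.dvd_mul.1 (Dvd.intro _ hcardZ)
    rcases (Nat.dvd_prime hp).1 ha with rfl | rfl <;> rcases (Nat.dvd_prime hq).1 hb with rfl | rfl
    · exact hsol hp (Nat.zero_le 2) (by rw [← hab, pow_zero, one_mul])
    · exact hsol hq one_le_two (by rw [← hab, pow_one, one_mul])
    · exact hsol hp one_le_two (by rw [← hab, pow_one, mul_one])
    · rw [← hab] at hcardZ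
      exact hZ1 (Nat.eq_of_mul_eq_mul_left (Nat.mul_pos hp.pos hq.pos)
        (hcardZ.trans (mul_one _).symm))
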